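/- For $n\ge 1$ let $P_{n-1}(\mathbb{R})$ be the space of real homogeneous polynomials of degree $n-1$ in two variables $X,Y$, let $P_{n-1}(\mathbb{Z})$ be its subgroup of polynomials with integer coefficients, and let $\operatorname{SL}_2(\mathbb{Z})$ act on $P_{n-1}(\mathbb{R})$ by $$\Big(\begin{pmatrix} a & b\\ c& d\end{pmatrix}\cdot P\Big)(X,Y)=P(aX+cY,\;bX+dY).$$ This action preserves $P_{n-1}(\mathbb{Z})$, and so it induces an action of $\operatorname{SL}_2(\mathbb{Z})$ by automorphisms on the torus $\mathbb{T}^n=P_{n-1}(\mathbb{R})/P_{n-1}(\mathbb{Z})$, which is identified with $(\mathbb{R}/\mathbb{Z})^n$ through the basis $X^{n-1},X^{n-2}Y,\ldots,Y^{n-1}$ and carries its normalized Lebesgue measure. For $n$ odd this action factors through $\operatorname{PSL}_2(\mathbb{Z})$. **Proposition.** Let $n$ be odd. If $H$ is a subgroup of $\operatorname{PSL}_2(\mathbb{Z})$ which is amenable (as a discrete group), then the action of $H$ on $\mathbb{T}^n$ is not ergodic. -/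

import Mathlib

open MeasureTheory
open scoped MatrixGroups

/-- A (discrete) group is amenable if it carries a left-invariant finitely additive probability
measure defined on all of its subsets. -/
def IsAmenableGroup (G : Type*) [Group G] : Prop :=
  ∃ m : Set G → ℝ,
    (∀ A, 0 ≤ m A) ∧ m Set.univ = 1 ∧
    (∀ A B, Disjoint A B → m (A ∪ B) = m A + m B) ∧
    ∀ (g : G) (A : Set G), m ((fun x => g * x) '' A) = m A

namespace LinearTorusAction

/-- The substitution `P(X, Y) ↦ P(aX + cY, bX + dY)` attached to `g = !![a, b; c, d]`, with
`X = X 0` and `Y = X 1`. -/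
noncomputable def subst (g : SL(2, ℤ)) :
    MvPolynomial (Fin 2) ℤ →ₐ[ℤ] MvPolynomial (Fin 2) ℤ :=
  MvPolynomial.aeval fun j =>
    MvPolynomial.C (g.1 0 j) * MvPolynomial.X 0 + MvPolynomial.C (g.1 1 j) * MvPolynomial.X 1

/-- The exponent of the monomial `X ^ (n - 1 - i) * Y ^ i`, for `0 ≤ i ≤ n - 1`. -/
noncomputable def expo (n : ℕ) (i : Fin n) : Fin 2 →₀ ℕ :=
  Finsupp.single 0 (n - 1 - i.1) + Finsupp.single 1 i.1

/-- The canonical basis monomial `X ^ (n - 1 - i) * Y ^ i` of the homogeneous polynomials of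
degree `n - 1`. -/
noncomputable def basisMonomial (n : ℕ) (i : Fin n) : MvPolynomial (Fin 2) ℤ :=
  MvPolynomial.X 0 ^ (n - 1 - i.1) * MvPolynomial.X 1 ^ i.1

/-- The matrix of the substitution `subst g` acting on homogeneous polynomials of degree `n - 1`,
in the canonical basis `X ^ (n - 1), X ^ (n - 2) * Y, …, Y ^ (n - 1)`. -/
noncomputable def rhoMatrix (n : ℕ) (g : SL(2, ℤ)) : Matrix (Fin n) (Fin n) ℤ :=
  Matrix.of fun i j => MvPolynomial.coeff (expo n i) (subst g (basisMonomial n j))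

theorem basisMonomial_eq (n : ℕ) (i : Fin n) :
    basisMonomial n i = MvPolynomial.monomial (expo n i) 1 := by
  simp [basisMonomial, expo, MvPolynomial.X_pow_eq_monomial, MvPolynomial.monomial_mul]

theorem expo_injective (n : ℕ) : Function.Injective (expo n) := by
  intro i j h
  have := DFunLike.congr_fun h 1
  simpa [expo, Fin.ext_iff] using this

theorem coeff_basisMonomial (n : ℕ) (i j : Fin n) :
    MvPolynomial.coeff (expo n i) (basisMonomial n j) = if i = j then 1 else 0 := by
  rw [basisMonomial_eq, MvPolynomial.coeff_monomial]
  simp [(expo_injective n).eq_iff, eq_comm]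

theorem isHomogeneous_basisMonomial (n : ℕ) (i : Fin n) :
    (basisMonomial n i).IsHomogeneous (n - 1) := by
  have h := ((MvPolynomial.isHomogeneous_X ℤ (0 : Fin 2)).pow (n - 1 - i.1)).mul
    ((MvPolynomial.isHomogeneous_X ℤ (1 : Fin 2)).pow i.1)
  have e : 1 * (n - 1 - i.1) + 1 * i.1 = n - 1 := by omega
  rwa [e] at h

theorem isHomogeneous_subst (n : ℕ) (g : SL(2, ℤ)) (i : Fin n) :
    (subst g (basisMonomial n i)).IsHomogeneous (n - 1) := by
  have h := (isHomogeneous_basisMonomial n i).aeval (n := 1) (fun j : Fin 2 =>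
    (MvPolynomial.C (g.1 0 j) * MvPolynomial.X 0 + MvPolynomial.C (g.1 1 j) * MvPolynomial.X 1 :
      MvPolynomial (Fin 2) ℤ))
    (fun j => by
      have h0 := (MvPolynomial.isHomogeneous_C (Fin 2) (g.1 0 j)).mul
        (MvPolynomial.isHomogeneous_X ℤ (0 : Fin 2))
      have h1 := (MvPolynomial.isHomogeneous_C (Fin 2) (g.1 1 j)).mul
        (MvPolynomial.isHomogeneous_X ℤ (1 : Fin 2))
      simpa using h0.add h1)
  rwa [one_mul] at h

/-- A homogeneous polynomial of degree `n - 1` is the combination of the basis monomials given by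
its coefficients. -/
theorem eq_sum_basisMonomial {n : ℕ} (hn : 0 < n) {p : MvPolynomial (Fin 2) ℤ}
    (hp : p.IsHomogeneous (n - 1)) :
    p = ∑ i : Fin n, MvPolynomial.C (MvPolynomial.coeff (expo n i) p) * basisMonomial n i := by
  ext d
  rw [MvPolynomial.coeff_sum]
  simp only [MvPolynomial.coeff_C_mul, basisMonomial_eq, MvPolynomial.coeff_monomial]
  by_cases hd : d.degree = n - 1
  · have hd' : d 0 + d 1 = n - 1 := by
      simpa [Finsupp.degree_eq_sum] using hd
    have hlt : d 1 < n := by omega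
    have he : expo n ⟨d 1, hlt⟩ = d := by
      ext k
      fin_cases k
      · simp [expo]; omega
      · simp [expo]
    rw [Finset.sum_eq_single ⟨d 1, hlt⟩]
    · simp [he]
    · intro b _ hb
      have : expo n b ≠ d := fun h => hb (expo_injective n (h.trans he.symm))
      simp [this]
    · simp
  · rw [hp.coeff_eq_zero hd, eq_comm]
    apply Finset.sum_eq_zero
    intro i _
    have : expo n i ≠ d := by
      rintro rfl
      apply hd
      have := i.2
      simp [expo, Finsupp.degree_eq_sum]
      omega
    simp [this]

theorem subst_one : subst 1 = AlgHom.id ℤ _ := by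
  ext j : 1
  fin_cases j <;> simp [subst]

theorem subst_mul (g h : SL(2, ℤ)) : subst (g * h) = (subst g).comp (subst h) := by
  ext j : 1
  simp [subst, Matrix.mul_apply, Fin.sum_univ_two]
  ring

/-- The representation `ρ_{n-1}` of `SL(2, ℤ)` on the integral homogeneous polynomials of degree
`n - 1`, in coordinates. -/
noncomputable def rho (n : ℕ) : SL(2, ℤ) →* Matrix (Fin n) (Fin n) ℤ where
  toFun := rhoMatrix n
  map_one' := by
    ext i j
    simp [rhoMatrix, subst_one, coeff_basisMonomial, Matrix.one_apply]
  map_mul' g h := by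
    ext i j
    have hn : 0 < n := i.pos
    have key := eq_sum_basisMonomial hn (isHomogeneous_subst n h j)
    simp only [rhoMatrix, Matrix.of_apply, Matrix.mul_apply, subst_mul, AlgHom.comp_apply]
    conv_lhs => rw [key]
    rw [map_sum, MvPolynomial.coeff_sum]
    refine Finset.sum_congr rfl fun k _ => ?_
    rw [← MvPolynomial.algebraMap_eq, map_mul, AlgHom.commutes, MvPolynomial.algebraMap_eq,
      MvPolynomial.coeff_C_mul, mul_comm]

/-- The torus `𝕋ⁿ = (ℝ / ℤ)ⁿ`, i.e. the homogeneous polynomials of degree `n - 1` with real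
coefficients modulo those with integer coefficients, in the canonical coordinates. Its `volume` is
the normalized Lebesgue (Haar) measure. -/
abbrev Torus (n : ℕ) : Type := Fin n → UnitAddCircle

/-- Integer matrices act on the torus by endomorphisms, through the matrix-vector product. -/
noncomputable def matrixToEnd (n : ℕ) :
    Matrix (Fin n) (Fin n) ℤ →* AddMonoid.End (Torus n) where
  toFun M :=
    { toFun := fun x i => ∑ j, M i j • x j
      map_zero' := by ext i; simp
      map_add' := fun x y => by ext i; simp [Finset.sum_add_distrib] }
  map_one' := by
    refine AddMonoidHom.ext fun x => funext fun i => ?_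
    change ∑ j, (1 : Matrix (Fin n) (Fin n) ℤ) i j • x j = x i
    simp [Matrix.one_apply]
  map_mul' M N := by
    refine AddMonoidHom.ext fun x => funext fun i => ?_
    change ∑ j, (M * N) i j • x j = ∑ k, M i k • ∑ j, N k j • x j
    simp only [Matrix.mul_apply, Finset.sum_smul, Finset.smul_sum, smul_smul]
    exact Finset.sum_comm

theorem rho_center {n : ℕ} (hn : Odd n) (z : SL(2, ℤ))
    (hz : z ∈ Subgroup.center SL(2, ℤ)) : rho n z = 1 := by
  obtain ⟨r, hr, hz⟩ := Matrix.SpecialLinearGroup.mem_center_iff.1 hz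
  have hr2 : r ^ 2 = 1 := by simpa using hr
  have hpow : r ^ (n - 1) = 1 := by
    obtain ⟨k, rfl⟩ := hn
    simp [pow_mul, hr2]
  have hent : ∀ a b, z.1 a b = if a = b then r else 0 := fun a b => by
    have h := congrFun (congrFun hz a) b
    rw [Matrix.scalar_apply, Matrix.diagonal_apply] at h
    exact h.symm
  ext i j
  have hs : subst z (basisMonomial n j) = basisMonomial n j := by
    have e : n - 1 - j.1 + j.1 = n - 1 := by omega
    have h0 : subst z (MvPolynomial.X 0) = MvPolynomial.C r * MvPolynomial.X 0 := by
      simp [subst, hent]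
    have h1 : subst z (MvPolynomial.X 1) = MvPolynomial.C r * MvPolynomial.X 1 := by
      simp [subst, hent]
    rw [basisMonomial, map_mul, map_pow, map_pow, h0, h1, mul_pow, mul_pow, mul_mul_mul_comm,
      ← pow_add, e, ← map_pow, hpow, map_one, one_mul]
  change MvPolynomial.coeff (expo n i) (subst z (basisMonomial n j)) = _
  rw [hs, coeff_basisMonomial, Matrix.one_apply]

/-- For `n` odd, the action of `SL(2, ℤ)` on the torus factors through `PSL(2, ℤ)`. -/
noncomputable def pslToEnd (n : ℕ) (hn : Odd n) : PSL(2, ℤ) →* AddMonoid.End (Torus n) :=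
  QuotientGroup.lift (Subgroup.center SL(2, ℤ)) ((matrixToEnd n).comp (rho n)) fun z hz => by
    simp [rho_center hn z hz]

/-- The linear action of `PSL(2, ℤ)` on `𝕋ⁿ`, for `n` odd. -/
@[reducible]
noncomputable def linearAction (n : ℕ) (hn : Odd n) : DistribMulAction PSL(2, ℤ) (Torus n) :=
  DistribMulAction.compHom (Torus n) (pslToEnd n hn)

/-- The class of `g` acts on the torus through the matrix of `ρ_{n-1}(g)`. -/
theorem linearAction_mk_smul (n : ℕ) (hn : Odd n) (g : SL(2, ℤ)) (x : Torus n) :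
    letI := linearAction n hn
    (QuotientGroup.mk g : PSL(2, ℤ)) • x = fun i => ∑ j, rhoMatrix n g i j • x j := rfl

/-- The linear action preserves the normalized Lebesgue measure. -/
theorem smulInvariantMeasure_linearAction (n : ℕ) (hn : Odd n) :
    letI := linearAction n hn
    SMulInvariantMeasure PSL(2, ℤ) (Torus n) volume := by
  let := linearAction n hn
  have hcont : ∀ g : PSL(2, ℤ), Continuous fun x : Torus n => g • x := by
    intro g
    induction g using QuotientGroup.induction_on with
    | H g =>
      change Continuous fun (x : Torus n) i => ∑ j, rhoMatrix n g i j • x j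
      fun_prop
  refine ⟨fun g s hs => ?_⟩
  have hmp := AddMonoidHom.measurePreserving (μ := (volume : Measure (Torus n)))
    (ν := (volume : Measure (Torus n)))
    (f := DistribSMul.toAddMonoidHom (Torus n) g) (hcont g) (MulAction.surjective g) rfl
  exact hmp.measure_preimage hs.nullMeasurableSet

end LinearTorusAction

/-!
Write `v ∧ w` for the determinant of two vectors of the plane. A matrix `g ∈ SL(2, ℤ)` preserves the
binary quadratic form `q_g(v) = v ∧ g v`, and so does every matrix of determinant one commuting
with `g`.

*Amenability forces commutation.* Let `g`, `h` have traces of absolute value at least `2`, with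
classes in the amenable group `H`. Suppose that the resultant of `q_g` and `q_h` is nonzero, so that
`|q_g| + |q_h|` is bounded below by a multiple of the square of the norm. By Cayley-Hamilton,
`v ∧ g ^ N v = u_N q_g(v)` with `|u_N| ≥ N`; so `g ^ N`, for `N` large, moves every nonzero vector
of the region `|q_h| ≤ |q_g|` out of this region (`exists_escape`). The set of elements of `H`
moving a given vector into this region therefore has three disjoint translates, and an invariant
mean gives it mass at most `1 / 3`. The same holds for the region `|q_g| ≤ |q_h|`; but the two sets
cover `H`, which is absurd. Hence the resultant vanishes
(`formResultant_eq_zero_of_isAmenableGroup`), and then `g` and `h` share a rational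
eigenvector unless they commute. An integral matrix of determinant one with a rational eigenvector
has trace `± 2`, and two such matrices with a common eigenvector commute anyway
(`commute_of_formResultant_eq_zero`).

*A finite orbit.* The elements of `Γ(3)` have trace congruent to `2` modulo `9`. Thus the elements
of `Γ(3)` with class in `H` commute with each other. If `g` is a nontrivial one, all of them
preserve `q_g`, hence commute with the differential operator `q_g(∂)`, and the functional
`P ↦ q_g(∂) ^ k P` on polynomials of degree `2 k = n - 1` is an integral covector which they fix
(`exists_fixed_covector`); it does not vanish on the `2 k`-th power of a linear form at which `q_g`
does not vanish. As `Γ(3)` has finite index, this covector has a finite orbit under `H`.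

*Conclusion.* The sum of the real parts of the characters of the torus in this orbit is an invariant
continuous function, positive at `0` and of integral zero. The set where it is positive is
invariant, and neither null nor conull.
-/

namespace LinearTorusAction

section
open scoped Matrix
open MvPolynomial

/-! ### Invariant means -/

/-- A set with three disjoint translates `A`, `k A`, `k ^ 2 A` has mass at most `1 / 3`. -/
theorem three_mul_mean_le_one {G : Type*} [Group G] {m : Set G → ℝ} (hnonneg : ∀ A, 0 ≤ m A)
    (huniv : m Set.univ = 1) (hadd : ∀ A B, Disjoint A B → m (A ∪ B) = m A + m B)
    (hinv : ∀ (g : G) (A : Set G), m ((fun x => g * x) '' A) = m A) (k : G) (A : Set G)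
    (h1 : ∀ x ∈ A, k * x ∉ A) (h2 : ∀ x ∈ A, k * (k * x) ∉ A) : 3 * m A ≤ 1 := by
  set B := (fun x => k * x) '' A with hB
  set C := (fun x => k * x) '' B with hC
  have hAB : Disjoint A B := by
    rw [Set.disjoint_right]
    rintro _ ⟨x, hx, rfl⟩
    exact h1 x hx
  have hBC : Disjoint B C := by
    rw [hC, hB, Set.disjoint_image_iff (mul_right_injective k), ← hB]
    exact hAB
  have hAC : Disjoint A C := by
    rw [Set.disjoint_right]
    rintro _ ⟨_, ⟨x, hx, rfl⟩, rfl⟩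
    exact h2 x hx
  have hmB : m B = m A := hinv k A
  have hmC : m C = m B := hinv k B
  have e1 := hadd B C hBC
  have e2 := hadd A (B ∪ C) (hAB.union_right hAC)
  have e3 := hadd _ _ (disjoint_compl_right (a := A ∪ (B ∪ C)))
  rw [Set.union_compl_self, huniv] at e3
  linarith [hnonneg (A ∪ (B ∪ C))ᶜ]

/-! ### The quadratic form preserved by a matrix -/

/-- The determinant `v ∧ w` of two vectors of the plane. -/
def wedge (v w : Fin 2 → ℤ) : ℤ := v 0 * w 1 - v 1 * w 0

/-- The binary quadratic form `v ↦ v ∧ g v`, whose zeros are the eigenvectors of `g`. -/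
def fixedForm (g : Matrix (Fin 2) (Fin 2) ℤ) (v : Fin 2 → ℤ) : ℤ := wedge v (g *ᵥ v)

theorem fixedForm_apply (g : Matrix (Fin 2) (Fin 2) ℤ) (v : Fin 2 → ℤ) :
    fixedForm g v = g 1 0 * v 0 ^ 2 + (g 1 1 - g 0 0) * v 0 * v 1 - g 0 1 * v 1 ^ 2 := by
  simp [fixedForm, wedge, Matrix.mulVec, dotProduct, Fin.sum_univ_two]
  ring

theorem wedge_mulVec (g : Matrix (Fin 2) (Fin 2) ℤ) (v w : Fin 2 → ℤ) :
    wedge (g *ᵥ v) (g *ᵥ w) = g.det * wedge v w := by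
  simp [wedge, Matrix.mulVec, dotProduct, Fin.sum_univ_two, Matrix.det_fin_two]
  ring

theorem wedge_sq_le (v w : Fin 2 → ℤ) :
    wedge v w ^ 2 ≤ (v 0 ^ 2 + v 1 ^ 2) * (w 0 ^ 2 + w 1 ^ 2) := by
  rw [wedge]
  nlinarith [sq_nonneg (v 0 * w 0 + v 1 * w 1)]

theorem fixedForm_mulVec {g k : Matrix (Fin 2) (Fin 2) ℤ} (hdet : k.det = 1) (h : g * k = k * g)
    (v : Fin 2 → ℤ) : fixedForm g (k *ᵥ v) = fixedForm g v := by
  rw [fixedForm, Matrix.mulVec_mulVec, h, ← Matrix.mulVec_mulVec, wedge_mulVec, hdet, one_mul]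
  rfl

/-- The resultant of the quadratic forms `fixedForm g` and `fixedForm h`. -/
def formResultant (g h : Matrix (Fin 2) (Fin 2) ℤ) : ℤ :=
  (h 1 0 * g 0 1 - g 1 0 * h 0 1) ^ 2 -
    (g 1 0 * (h 1 1 - h 0 0) - (g 1 1 - g 0 0) * h 1 0) *
      (g 0 1 * (h 1 1 - h 0 0) - (g 1 1 - g 0 0) * h 0 1)

theorem formResultant_comm (g h : Matrix (Fin 2) (Fin 2) ℤ) :
    formResultant g h = formResultant h g := by
  simp only [formResultant]
  ring

theorem abs_linear_combination_le (a b c d x y p q : ℤ) :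
    |(a * x + b * y) * p + (c * x + d * y) * q| ≤
      (|a| + |b| + |c| + |d|) * ((|x| + |y|) * (|p| + |q|)) := by
  have key : ∀ a b K : ℤ, |a| ≤ K → |b| ≤ K → |a * x + b * y| ≤ K * (|x| + |y|) := by
    intro a b K ha hb
    calc |a * x + b * y| ≤ |a * x| + |b * y| := abs_add_le _ _
      _ = |a| * |x| + |b| * |y| := by rw [abs_mul, abs_mul]
      _ ≤ K * |x| + K * |y| := by gcongr
      _ = _ := by ring
  have ha := abs_nonneg a
  have hb := abs_nonneg b
  have hc := abs_nonneg c
  have hd := abs_nonneg d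
  have h1 := key a b (|a| + |b| + |c| + |d|) (by linarith) (by linarith)
  have h2 := key c d (|a| + |b| + |c| + |d|) (by linarith) (by linarith)
  calc _ ≤ |(a * x + b * y) * p| + |(c * x + d * y) * q| := abs_add_le _ _
    _ = |a * x + b * y| * |p| + |c * x + d * y| * |q| := by rw [abs_mul, abs_mul]
    _ ≤ (|a| + |b| + |c| + |d|) * (|x| + |y|) * |p| +
        (|a| + |b| + |c| + |d|) * (|x| + |y|) * |q| := by gcongr
    _ = _ := by ring

/-- Two forms without common zero are not simultaneously small. The reason is that the resultant
times the cube of a coordinate lies in the ideal generated by the two forms. -/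
theorem exists_sq_add_sq_le {g h : Matrix (Fin 2) (Fin 2) ℤ} (hR : formResultant g h ≠ 0) :
    ∃ K : ℤ, 0 ≤ K ∧ ∀ v : Fin 2 → ℤ,
      v 0 ^ 2 + v 1 ^ 2 ≤ K * (|fixedForm g v| + |fixedForm h v|) := by
  obtain ⟨a, ha⟩ : ∃ a, a = g 1 0 := ⟨_, rfl⟩
  obtain ⟨b, hb⟩ : ∃ b, b = g 1 1 - g 0 0 := ⟨_, rfl⟩
  obtain ⟨c, hc⟩ : ∃ c, c = -g 0 1 := ⟨_, rfl⟩
  obtain ⟨d, hd⟩ : ∃ d, d = h 1 0 := ⟨_, rfl⟩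
  obtain ⟨e, he⟩ : ∃ e, e = h 1 1 - h 0 0 := ⟨_, rfl⟩
  obtain ⟨f, hf⟩ : ∃ f, f = -h 0 1 := ⟨_, rfl⟩
  have hq1 : ∀ v, fixedForm g v = a * v 0 ^ 2 + b * v 0 * v 1 + c * v 1 ^ 2 := by
    intro v
    rw [fixedForm_apply, ha, hb, hc]
    ring
  have hq2 : ∀ v, fixedForm h v = d * v 0 ^ 2 + e * v 0 * v 1 + f * v 1 ^ 2 := by
    intro v
    rw [fixedForm_apply, hd, he, hf]
    ring
  have hres : formResultant g h = (a * f - c * d) ^ 2 - (a * e - b * d) * (b * f - c * e) := by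
    rw [formResultant, ha, hb, hc, hd, he, hf]
    ring
  have hR1 : 1 ≤ |formResultant g h| := Int.one_le_abs hR
  have cube : ∀ K x S : ℤ, |formResultant g h * x ^ 3| ≤ K * S → |x| ^ 3 ≤ K * S := by
    intro K x S hx
    rw [abs_mul, abs_pow] at hx
    nlinarith [pow_nonneg (abs_nonneg x) 3]
  -- The coefficients below are cofactors of the Sylvester matrix of the two forms.
  set P := b * f - c * e
  set Q := a * f - c * d
  set T := a * e - b * d
  set K1 := |f * Q - e * P| + |-f * P| + |b * P - c * Q| + |c * P|
  set K2 := |d * T| + |e * T - d * Q| + |-a * T| + |a * Q - b * T|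
  have hx : ∀ v, |v 0| ^ 3 ≤ K1 * ((|v 0| + |v 1|) * (|fixedForm g v| + |fixedForm h v|)) := by
    intro v
    apply cube
    have := abs_linear_combination_le (f * Q - e * P) (-f * P) (b * P - c * Q) (c * P)
      (v 0) (v 1) (fixedForm g v) (fixedForm h v)
    convert this using 2
    rw [hres, hq1, hq2]
    ring
  have hy : ∀ v, |v 1| ^ 3 ≤ K2 * ((|v 0| + |v 1|) * (|fixedForm g v| + |fixedForm h v|)) := by
    intro v
    apply cube
    have := abs_linear_combination_le (d * T) (e * T - d * Q) (-a * T) (a * Q - b * T)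
      (v 0) (v 1) (fixedForm g v) (fixedForm h v)
    convert this using 2
    rw [hres, hq1, hq2]
    ring
  have hK1' : 0 ≤ K1 := by positivity
  have hK2' : 0 ≤ K2 := by positivity
  refine ⟨4 * (K1 + K2), by positivity, fun v => ?_⟩
  have h1 := hx v
  have h2 := hy v
  set S := |fixedForm g v| + |fixedForm h v|
  have hS : 0 ≤ S := by positivity
  have hx0 := abs_nonneg (v 0)
  have hy0 := abs_nonneg (v 1)
  rw [← sq_abs (v 0), ← sq_abs (v 1)]
  generalize |v 0| = x at *
  generalize |v 1| = y at *
  rcases (add_nonneg hx0 hy0).eq_or_lt' with h0 | hpos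
  · have : x = 0 := by linarith
    have : y = 0 := by linarith
    subst x y
    simp only [ne_eq, OfNat.ofNat_ne_zero, not_false_eq_true, zero_pow, add_zero]
    positivity
  · have h3 : (x + y) ^ 3 ≤ 4 * (x ^ 3 + y ^ 3) := by
      nlinarith [mul_nonneg hpos.le (sq_nonneg (x - y))]
    have h4 : (x + y) * (x + y) ^ 2 ≤ (x + y) * (4 * (K1 + K2) * S) := by nlinarith
    have h5 := le_of_mul_le_mul_left h4 hpos
    nlinarith [mul_nonneg hx0 hy0]

/-! ### Powers move vectors towards eigenvectors -/

/-- The Cayley-Hamilton expression of a power: the coefficient of `g` is a Chebyshev polynomial in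
the trace, and grows at least linearly. -/
theorem exists_pow_eq {g : Matrix (Fin 2) (Fin 2) ℤ} (hdet : g.det = 1)
    (ht : 2 ≤ |g 0 0 + g 1 1|) (N : ℕ) :
    ∃ u s : ℤ, g ^ (N + 1) = u • g + s • 1 ∧ (N : ℤ) + 1 ≤ |u| ∧ |s| + 1 ≤ |u| := by
  induction N with
  | zero => exact ⟨1, 0, by simp, by simp, by simp⟩
  | succ N ih =>
    obtain ⟨u, s, hg, hu, hs⟩ := ih
    refine ⟨u * (g 0 0 + g 1 1) + s, -u, ?_, ?_⟩
    · rw [pow_succ, hg]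
      rw [Matrix.det_fin_two] at hdet
      ext i j
      simp only [Matrix.mul_apply, Fin.sum_univ_two, Matrix.add_apply, Matrix.smul_apply,
        smul_eq_mul, Matrix.one_apply]
      fin_cases i <;> fin_cases j <;> simp
      · linear_combination (-u) * hdet
      · ring
      · ring
      · linear_combination (-u) * hdet
    · have h1 : |u * (g 0 0 + g 1 1)| ≤ |u * (g 0 0 + g 1 1) + s| + |s| := by
        simpa using abs_sub (u * (g 0 0 + g 1 1) + s) s
      rw [abs_mul] at h1
      have h2 : |u| * 2 ≤ |u| * |g 0 0 + g 1 1| := by gcongr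
      rw [abs_neg]
      push_cast
      constructor <;> linarith

/-- If `v` lies in the region where `q_g` dominates, then `|v| ^ 2` is bounded by a multiple of
`|q_g v|`. As `v ∧ g ^ N v = u_N q_g(v)` with `u_N` large, `g ^ N v` is much longer than `v`, while
`q_g` takes the same value at both vectors. So `q_h` must be the large one at `g ^ N v`. -/
theorem exists_escape {g h : Matrix (Fin 2) (Fin 2) ℤ} (hdet : g.det = 1)
    (ht : 2 ≤ |g 0 0 + g 1 1|) (hR : formResultant g h ≠ 0) :
    ∃ N₀ : ℕ, ∀ N ≥ N₀, ∀ v : Fin 2 → ℤ, v ≠ 0 → |fixedForm h v| ≤ |fixedForm g v| →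
      |fixedForm g (g ^ N *ᵥ v)| < |fixedForm h (g ^ N *ᵥ v)| := by
  obtain ⟨K, hK, hbound⟩ := exists_sq_add_sq_le hR
  refine ⟨(2 * K).toNat + 1, fun N hN v hv hle => ?_⟩
  obtain ⟨M, rfl⟩ : ∃ M, N = M + 1 := ⟨N - 1, by omega⟩
  obtain ⟨u, s, hpow, hu, -⟩ := exists_pow_eq hdet ht M
  by_contra! hle'
  set w := g ^ (M + 1) *ᵥ v with hw
  have hgw : fixedForm g w = fixedForm g v :=
    fixedForm_mulVec (by rw [Matrix.det_pow, hdet, one_pow]) (Commute.self_pow g _) v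
  have hwedge : wedge v w = u * fixedForm g v := by
    rw [hw, hpow, Matrix.add_mulVec, Matrix.smul_mulVec, Matrix.smul_mulVec, Matrix.one_mulVec,
      fixedForm]
    simp [wedge]
    ring
  rw [hgw] at hle'
  have h1 := hbound v
  have h2 := hbound w
  rw [hgw] at h2
  have h3 := wedge_sq_le v w
  rw [hwedge] at h3
  set p := |fixedForm g v| with hp
  have hp0 : 0 ≤ p := abs_nonneg _
  have h1' : v 0 ^ 2 + v 1 ^ 2 ≤ 2 * K * p := by nlinarith
  have h2' : w 0 ^ 2 + w 1 ^ 2 ≤ 2 * K * p := by nlinarith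
  have hvpos : 0 < v 0 ^ 2 + v 1 ^ 2 := by
    rcases (add_nonneg (sq_nonneg (v 0)) (sq_nonneg (v 1))).eq_or_lt' with h0 | h0
    · rw [add_eq_zero_iff_of_nonneg (sq_nonneg _) (sq_nonneg _), sq_eq_zero_iff,
        sq_eq_zero_iff] at h0
      refine absurd ?_ hv
      ext i
      fin_cases i
      · exact h0.1
      · exact h0.2
    · exact h0
  have hppos : 0 < p := by
    rcases hp0.eq_or_lt with h0 | h0
    · rw [← h0] at h1'
      linarith
    · exact h0
  have h4 : (|u| * p) ^ 2 ≤ (2 * K * p) ^ 2 := by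
    calc (|u| * p) ^ 2 = (u * fixedForm g v) ^ 2 := by rw [hp, ← abs_mul, sq_abs]
      _ ≤ _ := h3
      _ ≤ (2 * K * p) * (2 * K * p) := by gcongr
      _ = _ := by ring
  have h5 : |u| * p ≤ 2 * K * p := (sq_le_sq₀ (by positivity) (by positivity)).1 h4
  have h6 : |u| ≤ 2 * K := le_of_mul_le_mul_right h5 hppos
  have h7 : 2 * K ≤ M := by omega
  linarith

/-! ### Amenability and the resultant -/

/-- The two lifts to `SL(2, ℤ)` of an element of `PSL(2, ℤ)` differ by a central matrix, which
preserves every form `fixedForm g`. -/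
theorem fixedForm_mulVec_eq_of_mk_eq (g : SL(2, ℤ)) {k l : SL(2, ℤ)}
    (hkl : (QuotientGroup.mk k : PSL(2, ℤ)) = QuotientGroup.mk l) (v : Fin 2 → ℤ) :
    fixedForm g.1 (k.1 *ᵥ v) = fixedForm g.1 (l.1 *ᵥ v) := by
  have hz := QuotientGroup.eq.1 hkl
  set z := k⁻¹ * l with hzdef
  have hl : l = z * k := by
    rw [← Subgroup.mem_center_iff.1 hz k, hzdef, mul_inv_cancel_left]
  have hcomm : g.1 * z.1 = z.1 * g.1 := congrArg Subtype.val (Subgroup.mem_center_iff.1 hz g)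
  rw [hl, Matrix.SpecialLinearGroup.coe_mul, ← Matrix.mulVec_mulVec,
    fixedForm_mulVec z.2 hcomm]

/-- The elements of `H` moving the first basis vector into the region `|q_h| ≤ |q_g|`,
the condition being independent of the lift to `SL(2, ℤ)`. -/
def dominatedSet (H : Subgroup PSL(2, ℤ)) (g h : SL(2, ℤ)) : Set H :=
  {x | ∃ k : SL(2, ℤ), QuotientGroup.mk k = x.1 ∧
    |fixedForm h.1 (k.1 *ᵥ ![1, 0])| ≤ |fixedForm g.1 (k.1 *ᵥ ![1, 0])|}

theorem mulVec_basis_ne_zero (k : SL(2, ℤ)) : k.1 *ᵥ ![1, 0] ≠ 0 := by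
  intro h0
  have h : k⁻¹.1 *ᵥ (k.1 *ᵥ ![1, 0]) = 0 := by rw [h0, Matrix.mulVec_zero]
  rw [Matrix.mulVec_mulVec, ← Matrix.SpecialLinearGroup.coe_mul, inv_mul_cancel,
    Matrix.SpecialLinearGroup.coe_one, Matrix.one_mulVec] at h
  simpa using congrFun h 0

theorem exists_escape_dominatedSet {H : Subgroup PSL(2, ℤ)} {g h : SL(2, ℤ)}
    (hg : (QuotientGroup.mk g : PSL(2, ℤ)) ∈ H) (ht : 2 ≤ |g.1 0 0 + g.1 1 1|)
    (hR : formResultant g.1 h.1 ≠ 0) :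
    ∃ k : H, (∀ x ∈ dominatedSet H g h, k * x ∉ dominatedSet H g h) ∧
      ∀ x ∈ dominatedSet H g h, k * (k * x) ∉ dominatedSet H g h := by
  obtain ⟨N, hN⟩ := exists_escape g.2 ht hR
  have key : ∀ M ≥ N, ∀ x ∈ dominatedSet H g h,
      (⟨QuotientGroup.mk g, hg⟩ : H) ^ M * x ∉ dominatedSet H g h := by
    rintro M hM x ⟨k, hk, hle⟩ ⟨l, hl, hle'⟩
    have hmk : (QuotientGroup.mk l : PSL(2, ℤ)) = QuotientGroup.mk (g ^ M * k) := by
      rw [hl, QuotientGroup.mk_mul, QuotientGroup.mk_pow, hk]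
      rfl
    rw [fixedForm_mulVec_eq_of_mk_eq g hmk, fixedForm_mulVec_eq_of_mk_eq h hmk,
      Matrix.SpecialLinearGroup.coe_mul, Matrix.SpecialLinearGroup.coe_pow,
      ← Matrix.mulVec_mulVec] at hle'
    exact (hN M hM _ (mulVec_basis_ne_zero k) hle).not_ge hle'
  refine ⟨(⟨QuotientGroup.mk g, hg⟩ : H) ^ N, key N le_rfl, fun x hx => ?_⟩
  rw [← mul_assoc, ← pow_add]
  exact key (N + N) (by omega) x hx

theorem formResultant_eq_zero_of_isAmenableGroup {H : Subgroup PSL(2, ℤ)} (hH : IsAmenableGroup H)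
    {g h : SL(2, ℤ)} (hg : (QuotientGroup.mk g : PSL(2, ℤ)) ∈ H)
    (hh : (QuotientGroup.mk h : PSL(2, ℤ)) ∈ H) (htg : 2 ≤ |g.1 0 0 + g.1 1 1|)
    (hth : 2 ≤ |h.1 0 0 + h.1 1 1|) : formResultant g.1 h.1 = 0 := by
  by_contra hR
  obtain ⟨m, hnonneg, huniv, hadd, hinv⟩ := hH
  obtain ⟨k, hk1, hk2⟩ := exists_escape_dominatedSet hg htg hR
  obtain ⟨l, hl1, hl2⟩ := exists_escape_dominatedSet hh hth (formResultant_comm g.1 h.1 ▸ hR)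
  have h1 := three_mul_mean_le_one hnonneg huniv hadd hinv k _ hk1 hk2
  have h2 := three_mul_mean_le_one hnonneg huniv hadd hinv l _ hl1 hl2
  have hcover : (dominatedSet H g h)ᶜ ⊆ dominatedSet H h g := by
    intro x hx
    obtain ⟨k, hk⟩ := QuotientGroup.mk_surjective x.1
    refine ⟨k, hk, ?_⟩
    by_contra! hlt
    exact hx ⟨k, hk, hlt.le⟩
  have h3 := hadd _ _ (disjoint_compl_right (a := dominatedSet H g h))
  rw [Set.union_compl_self, huniv] at h3
  have h4 := hadd _ _ (disjoint_sdiff_self_right (x := (dominatedSet H g h)ᶜ)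
    (y := dominatedSet H h g))
  rw [Set.union_sdiff_cancel hcover] at h4
  linarith [hnonneg (dominatedSet H h g \ (dominatedSet H g h)ᶜ)]

/-! ### Matrices with a common eigenvector -/

theorem eq_zero_of_sq_sub_four_eq_sq {t r : ℤ} (h : t ^ 2 - 4 = r ^ 2) : r = 0 := by
  have h1 : |r| < |t| := sq_lt_sq.1 (by linarith)
  have h2 := abs_nonneg r
  rw [← sq_abs t, ← sq_abs r] at h
  rw [← abs_eq_zero]
  generalize |t| = T at *
  generalize |r| = S at *
  have hS : S ≤ 1 := by nlinarith
  have hT : T ≤ 2 := by nlinarith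
  interval_cases S <;> interval_cases T <;> omega

/-- A matrix of determinant one with an integral eigenvector has discriminant zero, so that its
form is a multiple of the square of the linear form vanishing at the eigenvector. -/
theorem polar_eq_zero_of_fixedForm_eq_zero {g : Matrix (Fin 2) (Fin 2) ℤ} (hdet : g.det = 1)
    {v : Fin 2 → ℤ} (hv : v ≠ 0) (h0 : fixedForm g v = 0) :
    2 * g 1 0 * v 0 + (g 1 1 - g 0 0) * v 1 = 0 ∧
      (g 1 1 - g 0 0) * v 0 - 2 * g 0 1 * v 1 = 0 := by
  rw [fixedForm_apply] at h0
  rw [Matrix.det_fin_two] at hdet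
  set t := g 0 0 + g 1 1 with ht
  have hs1 : (2 * g 1 0 * v 0 + (g 1 1 - g 0 0) * v 1) ^ 2 = (t ^ 2 - 4) * v 1 ^ 2 := by
    rw [ht]
    linear_combination 4 * g 1 0 * h0 - 4 * v 1 ^ 2 * hdet
  have hs0 : ((g 1 1 - g 0 0) * v 0 - 2 * g 0 1 * v 1) ^ 2 = (t ^ 2 - 4) * v 0 ^ 2 := by
    rw [ht]
    linear_combination -4 * g 0 1 * h0 - 4 * v 0 ^ 2 * hdet
  have disc : ∀ x s : ℤ, x ≠ 0 → s ^ 2 = (t ^ 2 - 4) * x ^ 2 → t ^ 2 - 4 = 0 := by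
    intro x s hx hs
    obtain ⟨r, rfl⟩ : x ∣ s := (Int.pow_dvd_pow_iff two_ne_zero).1 ⟨t ^ 2 - 4, by rw [hs]; ring⟩
    have hr : t ^ 2 - 4 = r ^ 2 := by
      apply mul_right_cancel₀ (pow_ne_zero 2 hx)
      rw [← hs]
      ring
    rw [hr, eq_zero_of_sq_sub_four_eq_sq hr]
    rfl
  have hD : t ^ 2 - 4 = 0 := by
    by_cases hx : v 0 = 0
    · refine disc (v 1) _ (fun hy => hv ?_) hs1
      ext i
      fin_cases i
      · exact hx
      · exact hy
    · exact disc (v 0) _ hx hs0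
  rw [hD, zero_mul] at hs0 hs1
  exact ⟨pow_eq_zero_iff two_ne_zero |>.1 hs1, pow_eq_zero_iff two_ne_zero |>.1 hs0⟩

theorem wedge_eq_zero_of_orthogonal {a b c d : ℤ} {v : Fin 2 → ℤ} (hv : v ≠ 0)
    (h1 : a * v 0 + b * v 1 = 0) (h2 : c * v 0 + d * v 1 = 0) : a * d - b * c = 0 := by
  by_contra h
  apply hv
  ext i
  fin_cases i
  · exact (mul_eq_zero.1 (show (a * d - b * c) * v 0 = 0 by
      linear_combination d * h1 - b * h2)).resolve_left h
  · exact (mul_eq_zero.1 (show (a * d - b * c) * v 1 = 0 by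
      linear_combination a * h2 - c * h1)).resolve_left h

theorem commute_of_fixedForm_eq_zero {g h : Matrix (Fin 2) (Fin 2) ℤ} (hg : g.det = 1)
    (hh : h.det = 1) {v : Fin 2 → ℤ} (hv : v ≠ 0) (hgv : fixedForm g v = 0)
    (hhv : fixedForm h v = 0) : g * h = h * g := by
  obtain ⟨g1, g2⟩ := polar_eq_zero_of_fixedForm_eq_zero hg hv hgv
  obtain ⟨h1, h2⟩ := polar_eq_zero_of_fixedForm_eq_zero hh hv hhv
  rw [sub_eq_add_neg, ← neg_mul] at g2 h2
  have e1 := wedge_eq_zero_of_orthogonal hv g1 h1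
  have e2 := wedge_eq_zero_of_orthogonal hv g2 h2
  have e3 := wedge_eq_zero_of_orthogonal hv g1 h2
  have e4 := wedge_eq_zero_of_orthogonal hv h1 g2
  ext i j
  fin_cases i <;> fin_cases j <;> simp [Matrix.mul_apply, Fin.sum_univ_two] <;> linarith

theorem commute_of_formResultant_eq_zero {g h : Matrix (Fin 2) (Fin 2) ℤ} (hg : g.det = 1)
    (hh : h.det = 1) (hR : formResultant g h = 0) : g * h = h * g := by
  obtain ⟨p, hp⟩ : ∃ p, p = g 1 0 * (h 1 1 - h 0 0) - (g 1 1 - g 0 0) * h 1 0 := ⟨_, rfl⟩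
  obtain ⟨q, hq⟩ : ∃ q, q = h 1 0 * g 0 1 - g 1 0 * h 0 1 := ⟨_, rfl⟩
  obtain ⟨r, hr⟩ : ∃ r, r = g 0 1 * (h 1 1 - h 0 0) - (g 1 1 - g 0 0) * h 0 1 := ⟨_, rfl⟩
  have hR' : q ^ 2 - p * r = 0 := by rw [hp, hq, hr]; exact hR
  have I1 : g 1 0 * r - (g 1 1 - g 0 0) * q - g 0 1 * p = 0 := by rw [hp, hq, hr]; ring
  have I2 : h 1 0 * r - (h 1 1 - h 0 0) * q - h 0 1 * p = 0 := by rw [hp, hq, hr]; ring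
  -- The matrix `g * h - h * g` has entries `± p`, `± q`, `± r` and is nilpotent; its kernel is
  -- spanned by whichever of the next two vectors is nonzero, and consists of
  -- eigenvectors of `g` and of `h`.
  by_cases h1 : (![q, -p] : Fin 2 → ℤ) = 0
  · have hq0 : q = 0 := by simpa using congrFun h1 0
    have hp0 : p = 0 := by simpa using congrFun h1 1
    by_cases h2 : (![r, -q] : Fin 2 → ℤ) = 0
    · have hr0 : r = 0 := by simpa using congrFun h2 0
      rw [hq0] at hq
      rw [hp0] at hp
      rw [hr0] at hr
      ext i j
      fin_cases i <;> fin_cases j <;> simp [Matrix.mul_apply, Fin.sum_univ_two] <;> linarith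
    · refine commute_of_fixedForm_eq_zero hg hh h2 ?_ ?_
      · rw [fixedForm_apply]
        simp
        linear_combination r * I1 - g 0 1 * hR'
      · rw [fixedForm_apply]
        simp
        linear_combination r * I2 - h 0 1 * hR'
  · refine commute_of_fixedForm_eq_zero hg hh h1 ?_ ?_
    · rw [fixedForm_apply]
      simp
      linear_combination p * I1 + g 1 0 * hR'
    · rw [fixedForm_apply]
      simp
      linear_combination p * I2 + h 1 0 * hR'

theorem two_le_abs_trace_of_mem_Gamma_three {g : SL(2, ℤ)}
    (hg : g ∈ CongruenceSubgroup.Gamma 3) : 2 ≤ |g.1 0 0 + g.1 1 1| := by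
  obtain ⟨h00, h01, h10, h11⟩ := CongruenceSubgroup.Gamma_mem.1 hg
  have e00 : (3 : ℤ) ∣ g.1 0 0 - 1 := by
    apply (ZMod.intCast_zmod_eq_zero_iff_dvd _ 3).1
    push_cast
    exact sub_eq_zero.2 h00
  have e11 : (3 : ℤ) ∣ g.1 1 1 - 1 := by
    apply (ZMod.intCast_zmod_eq_zero_iff_dvd _ 3).1
    push_cast
    exact sub_eq_zero.2 h11
  have e01 : (3 : ℤ) ∣ g.1 0 1 := (ZMod.intCast_zmod_eq_zero_iff_dvd _ 3).1 h01
  have e10 : (3 : ℤ) ∣ g.1 1 0 := (ZMod.intCast_zmod_eq_zero_iff_dvd _ 3).1 h10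
  obtain ⟨p, hp⟩ := e00
  obtain ⟨q, hq⟩ := e01
  obtain ⟨r, hr⟩ := e10
  obtain ⟨s, hs⟩ := e11
  have hdet := g.2
  rw [Matrix.det_fin_two, hq, hr, eq_add_of_sub_eq hp, eq_add_of_sub_eq hs] at hdet
  -- The determinant condition shows that the trace is congruent to `2` modulo `9`.
  have htr : g.1 0 0 + g.1 1 1 = 2 + 9 * (q * r - p * s) := by linear_combination hp + hs + hdet
  rw [htr]
  exact le_abs.2 (by omega)

/-! ### Covectors fixed by a centralizer -/

/-- The differential operator `a ∂_X ^ 2 + b ∂_X ∂_Y + c ∂_Y ^ 2`. -/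
noncomputable def formOp (a b c : ℤ) : Module.End ℤ (MvPolynomial (Fin 2) ℤ) :=
  a • ((pderiv 0).toLinearMap ∘ₗ (pderiv 0).toLinearMap) +
    b • ((pderiv 0).toLinearMap ∘ₗ (pderiv 1).toLinearMap) +
      c • ((pderiv 1).toLinearMap ∘ₗ (pderiv 1).toLinearMap)

theorem formOp_apply (a b c : ℤ) (P : MvPolynomial (Fin 2) ℤ) :
    formOp a b c P = C a * pderiv 0 (pderiv 0 P) + C b * pderiv 0 (pderiv 1 P) +
      C c * pderiv 1 (pderiv 1 P) := by
  simp [formOp, smul_eq_C_mul]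

theorem pderiv_one_pderiv_zero (P : MvPolynomial (Fin 2) ℤ) :
    pderiv 1 (pderiv 0 P) = pderiv 0 (pderiv 1 P) := by
  -- The commutator of the two derivations vanishes on the variables.
  have h : ⁅(pderiv 1 : Derivation ℤ (MvPolynomial (Fin 2) ℤ) (MvPolynomial (Fin 2) ℤ)),
      (pderiv 0 : Derivation ℤ (MvPolynomial (Fin 2) ℤ) (MvPolynomial (Fin 2) ℤ))⁆ = 0 := by
    refine MvPolynomial.derivation_ext fun i => ?_
    fin_cases i <;> simp [Derivation.commutator_apply, pderiv_X]
  have h' := congrArg (fun D => D P) h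
  rwa [Derivation.commutator_apply, Derivation.zero_apply, sub_eq_zero] at h'

theorem subst_C (k : SL(2, ℤ)) (a : ℤ) : subst k (C a) = C a := by
  rw [← algebraMap_eq, AlgHom.commutes]

theorem subst_X (k : SL(2, ℤ)) (j : Fin 2) :
    subst k (X j) = C (k.1 0 j) * X 0 + C (k.1 1 j) * X 1 := by
  simp [subst]

/-- The chain rule for a linear substitution. -/
theorem pderiv_subst (k : SL(2, ℤ)) (i : Fin 2) (P : MvPolynomial (Fin 2) ℤ) :
    pderiv i (subst k P) =
      C (k.1 i 0) * subst k (pderiv 0 P) + C (k.1 i 1) * subst k (pderiv 1 P) := by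
  induction P using MvPolynomial.induction_on with
  | C a => simp
  | add p q hp hq =>
    simp only [map_add, hp, hq]
    ring
  | mul_X p j hp =>
    simp only [map_mul, Derivation.leibniz, hp, smul_eq_mul, map_add, subst_X, pderiv_C]
    fin_cases i <;> fin_cases j <;> simp [pderiv_X] <;> ring

/-- A substitution commutes with the differential operator attached to a quadratic form which its
matrix preserves: the hypotheses compare the coefficients of the form before and after. -/
theorem formOp_subst {a b c : ℤ} {k : SL(2, ℤ)}
    (h0 : a * k.1 0 0 ^ 2 + b * k.1 0 0 * k.1 1 0 + c * k.1 1 0 ^ 2 = a)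
    (h1 : 2 * a * k.1 0 0 * k.1 0 1 + b * (k.1 0 0 * k.1 1 1 + k.1 0 1 * k.1 1 0) +
      2 * c * k.1 1 0 * k.1 1 1 = b)
    (h2 : a * k.1 0 1 ^ 2 + b * k.1 0 1 * k.1 1 1 + c * k.1 1 1 ^ 2 = c)
    (P : MvPolynomial (Fin 2) ℤ) : formOp a b c (subst k P) = subst k (formOp a b c P) := by
  have h0' := congrArg (C (σ := Fin 2)) h0
  have h1' := congrArg (C (σ := Fin 2)) h1
  have h2' := congrArg (C (σ := Fin 2)) h2
  have hc : pderiv 1 (pderiv 0 P) = pderiv 0 (pderiv 1 P) := pderiv_one_pderiv_zero P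
  simp only [map_add, map_mul, map_pow, map_ofNat] at h0' h1' h2'
  simp only [formOp_apply, pderiv_subst, map_add, map_mul, Derivation.leibniz, pderiv_C,
    smul_eq_mul, subst_C, hc]
  linear_combination subst k (pderiv 0 (pderiv 0 P)) * h0' +
    subst k (pderiv 0 (pderiv 1 P)) * h1' + subst k (pderiv 1 (pderiv 1 P)) * h2'

theorem pderiv_linear_pow (v : Fin 2 → ℤ) (i : Fin 2) (m : ℕ) :
    pderiv i ((C (v 0) * X 0 + C (v 1) * X 1) ^ (m + 1)) =
      C ((m + 1) * v i) * (C (v 0) * X 0 + C (v 1) * X 1 : MvPolynomial (Fin 2) ℤ) ^ m := by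
  rw [Derivation.leibniz_pow]
  fin_cases i <;> simp [pderiv_X] <;> ring

theorem exists_formOp_pow_linear_pow {a b c : ℤ} {v : Fin 2 → ℤ}
    (hv : a * v 0 ^ 2 + b * v 0 * v 1 + c * v 1 ^ 2 ≠ 0) (k : ℕ) :
    ∃ r : ℤ, r ≠ 0 ∧ (formOp a b c ^ k) ((C (v 0) * X 0 + C (v 1) * X 1) ^ (2 * k)) = C r := by
  induction k with
  | zero => exact ⟨1, one_ne_zero, by simp⟩
  | succ k ih =>
    obtain ⟨r, hr, h⟩ := ih
    have key : formOp a b c ((C (v 0) * X 0 + C (v 1) * X 1) ^ (2 * k + 1 + 1)) =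
        ((2 * k + 2) * (2 * k + 1) * (a * v 0 ^ 2 + b * v 0 * v 1 + c * v 1 ^ 2)) •
          (C (v 0) * X 0 + C (v 1) * X 1 : MvPolynomial (Fin 2) ℤ) ^ (2 * k) := by
      rw [formOp_apply]
      simp only [pderiv_linear_pow, Derivation.leibniz, pderiv_C, smul_eq_mul,
        smul_eq_C_mul]
      simp only [map_mul, map_add, map_pow]
      push_cast
      simp
      ring
    refine ⟨(2 * k + 2) * (2 * k + 1) * (a * v 0 ^ 2 + b * v 0 * v 1 + c * v 1 ^ 2) * r, ?_, ?_⟩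
    · exact mul_ne_zero (mul_ne_zero (by positivity) hv) hr
    · rw [pow_succ, Module.End.mul_apply, show 2 * (k + 1) = 2 * k + 1 + 1 by ring, key, map_smul,
        h, smul_eq_C_mul, ← C_mul]

theorem constantCoeff_subst (k : SL(2, ℤ)) (P : MvPolynomial (Fin 2) ℤ) :
    constantCoeff (subst k P) = constantCoeff P := by
  induction P using MvPolynomial.induction_on with
  | C a => simp
  | add p q hp hq => simp [hp, hq]
  | mul_X p j hp => simp [subst_X]

/-- The covector is the functional `P ↦ q_g(∂) ^ k P` on homogeneous polynomials of degree
`n - 1 = 2 k`. -/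
theorem exists_fixed_covector {n : ℕ} (hn : Odd n) {g : SL(2, ℤ)} {v : Fin 2 → ℤ}
    (hv : fixedForm g.1 v ≠ 0) :
    ∃ w : Fin n → ℤ, w ≠ 0 ∧ ∀ k : SL(2, ℤ), g * k = k * g → w ᵥ* rho n k = w := by
  obtain ⟨m, rfl⟩ := hn
  set D := formOp (g.1 1 0) (g.1 1 1 - g.1 0 0) (-g.1 0 1) with hD
  let L : MvPolynomial (Fin 2) ℤ → ℤ := fun P => constantCoeff ((D ^ m) P)
  have hL : ∀ P : MvPolynomial (Fin 2) ℤ, P.IsHomogeneous (2 * m + 1 - 1) →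
      L P = ∑ i, coeff (expo (2 * m + 1) i) P * L (basisMonomial (2 * m + 1) i) := by
    intro P hP
    have h := congrArg L (eq_sum_basisMonomial (Nat.succ_pos _) hP)
    rw [h]
    simp only [L, map_sum, ← smul_eq_C_mul, map_smul, constantCoeff_smul, smul_eq_mul]
  refine ⟨fun i => L (basisMonomial _ i), fun h0 => ?_, fun k hk => ?_⟩
  · obtain ⟨r, hr, h⟩ := exists_formOp_pow_linear_pow (a := g.1 1 0) (b := g.1 1 1 - g.1 0 0)
      (c := -g.1 0 1) (v := v) (by rw [fixedForm_apply] at hv; convert hv using 1; ring) m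
    have hhom : ((C (v 0) * X 0 + C (v 1) * X 1 : MvPolynomial (Fin 2) ℤ) ^ (2 * m)).IsHomogeneous
        (2 * m + 1 - 1) := by
      have h1 := (isHomogeneous_C (Fin 2) (v 0)).mul (isHomogeneous_X ℤ (0 : Fin 2))
      have h2 := (isHomogeneous_C (Fin 2) (v 1)).mul (isHomogeneous_X ℤ (1 : Fin 2))
      simpa using (h1.add h2).pow (2 * m)
    have h1 := hL _ hhom
    rw [Finset.sum_eq_zero fun i _ => by rw [show L (basisMonomial _ i) = 0 from congrFun h0 i,
      mul_zero]] at h1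
    apply hr
    rw [← h1]
    simp only [L, hD, h, constantCoeff_C]
  · have hcomm : g.1 * k.1 = k.1 * g.1 := congrArg Subtype.val hk
    -- Invariance of the form at three vectors amounts to invariance of its coefficients.
    have hinv := fun x y => fixedForm_mulVec k.2 hcomm ![x, y]
    have e0 := hinv 1 0
    have e1 := hinv 0 1
    have e2 := hinv 1 1
    simp [fixedForm_apply] at e0 e1 e2
    have hsemi : ∀ P, D (subst k P) = subst k (D P) :=
      formOp_subst (by linarith) (by linarith) (by linarith)
    have hpow : ∀ (j : ℕ) P, (D ^ j) (subst k P) = subst k ((D ^ j) P) := by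
      intro j P
      rw [Module.End.pow_apply, Module.End.pow_apply]
      exact (Function.Semiconj.iterate_right (f := subst k) (fun P => (hsemi P).symm) j P).symm
    ext j
    change ∑ i, L (basisMonomial _ i) * coeff _ (subst k (basisMonomial _ j)) = _
    simp_rw [mul_comm (L _)]
    rw [← hL _ (isHomogeneous_subst _ k j)]
    simp only [L, hpow, constantCoeff_subst]

theorem exists_fixedForm_ne_zero {g : SL(2, ℤ)} {h : SL(2, ℤ)} (hgh : g * h ≠ h * g) :
    ∃ v, fixedForm g.1 v ≠ 0 := by
  by_contra! h0
  apply hgh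
  have e0 := h0 ![1, 0]
  have e1 := h0 ![0, 1]
  have e2 := h0 ![1, 1]
  simp [fixedForm_apply] at e0 e1 e2
  have e3 : g.1 1 1 = g.1 0 0 := by linarith
  ext i j
  fin_cases i <;> fin_cases j <;>
    simp [Matrix.mul_apply, Fin.sum_univ_two, e0, e1, e3, mul_comm]

theorem exists_covector_fixed_by_Gamma_three {n : ℕ} (hn : Odd n) {H : Subgroup PSL(2, ℤ)}
    (hH : IsAmenableGroup H) :
    ∃ w : Fin n → ℤ, w ≠ 0 ∧ ∀ k ∈ CongruenceSubgroup.Gamma 3,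
      (QuotientGroup.mk k : PSL(2, ℤ)) ∈ H → w ᵥ* rho n k = w := by
  by_cases hex : ∃ g ∈ CongruenceSubgroup.Gamma 3, (QuotientGroup.mk g : PSL(2, ℤ)) ∈ H ∧
      ∃ v, fixedForm g.1 v ≠ 0
  · obtain ⟨g, hg, hgH, v, hv⟩ := hex
    obtain ⟨w, hw, hfix⟩ := exists_fixed_covector hn hv
    refine ⟨w, hw, fun k hk hkH => hfix k (Subtype.ext ?_)⟩
    exact commute_of_formResultant_eq_zero g.2 k.2 (formResultant_eq_zero_of_isAmenableGroup hH
      hgH hkH (two_le_abs_trace_of_mem_Gamma_three hg) (two_le_abs_trace_of_mem_Gamma_three hk))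
  · -- Otherwise these elements are central, and fix every covector.
    push Not at hex
    refine ⟨fun _ => 1, fun h0 => one_ne_zero (congrFun h0 ⟨0, hn.pos⟩), fun k hk hkH => ?_⟩
    have hcent : k ∈ Subgroup.center SL(2, ℤ) := by
      rw [Subgroup.mem_center_iff]
      intro h
      by_contra hne
      obtain ⟨v, hv⟩ := exists_fixedForm_ne_zero (Ne.symm hne)
      exact hv (hex k hk hkH v)
    rw [rho_center hn k hcent, Matrix.vecMul_one]

/-- The finite set is the `H`-orbit of a covector fixed by the part of `Γ(3)` lying over `H`. -/
theorem exists_finite_invariant {n : ℕ} (hn : Odd n) {H : Subgroup PSL(2, ℤ)}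
    (hH : IsAmenableGroup H) :
    ∃ O : Finset (Fin n → ℤ), O.Nonempty ∧ 0 ∉ O ∧ ∀ k : SL(2, ℤ),
      (QuotientGroup.mk k : PSL(2, ℤ)) ∈ H → ∀ w ∈ O, w ᵥ* rho n k ∈ O := by
  obtain ⟨w, hw, hfix⟩ := exists_covector_fixed_by_Gamma_three hn hH
  set S : Set (Fin n → ℤ) :=
    {u | ∃ k : SL(2, ℤ), (QuotientGroup.mk k : PSL(2, ℤ)) ∈ H ∧ w ᵥ* rho n k = u} with hS
  have hfin : S.Finite := by
    -- A point `w ρ(k)` of the orbit depends only on the reduction of `k` modulo `3`.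
    choose! f hf using fun u (hu : u ∈ S) => hu
    refine Set.Finite.of_injOn (t := Set.univ)
      (f := fun u => Matrix.SpecialLinearGroup.map (Int.castRingHom (ZMod 3)) (f u))
      (fun _ _ => Set.mem_univ _) ?_ Set.finite_univ
    intro u hu u' hu' heq
    have hmem : f u * (f u')⁻¹ ∈ CongruenceSubgroup.Gamma 3 := by
      rw [CongruenceSubgroup.Gamma_mem', map_mul, map_inv, mul_inv_eq_one]
      exact heq
    have hmemH : (QuotientGroup.mk (f u * (f u')⁻¹) : PSL(2, ℤ)) ∈ H :=
      H.mul_mem (hf u hu).1 (H.inv_mem (hf u' hu').1)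
    rw [← (hf u hu).2, ← (hf u' hu').2, ← inv_mul_cancel_right (f u) (f u'), map_mul,
      ← Matrix.vecMul_vecMul, hfix _ hmem hmemH]
  refine ⟨hfin.toFinset, ⟨w, ?_⟩, ?_, ?_⟩
  · rw [Set.Finite.mem_toFinset]
    exact ⟨1, H.one_mem, by rw [map_one, Matrix.vecMul_one]⟩
  · rw [Set.Finite.mem_toFinset]
    rintro ⟨k, -, hk⟩
    apply hw
    rw [← Matrix.vecMul_one w, ← map_one (rho n), ← mul_inv_cancel k, map_mul,
      ← Matrix.vecMul_vecMul, hk, Matrix.zero_vecMul]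
  · intro k hk u hu
    rw [Set.Finite.mem_toFinset] at hu ⊢
    obtain ⟨l, hl, rfl⟩ := hu
    exact ⟨l * k, H.mul_mem hl hk, by rw [map_mul, Matrix.vecMul_vecMul]⟩

/-! ### Characters of the torus -/

/-- The character of the torus attached to an integral covector. -/
noncomputable def torusChar {n : ℕ} (w : Fin n → ℤ) (x : Torus n) : ℂ :=
  AddCircle.toCircle (∑ i, w i • x i)

theorem continuous_torusChar {n : ℕ} (w : Fin n → ℤ) : Continuous (torusChar w) := by
  unfold torusChar
  have := AddCircle.continuous_toCircle (T := 1)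
  fun_prop

theorem torusChar_add {n : ℕ} (w : Fin n → ℤ) (x y : Torus n) :
    torusChar w (x + y) = torusChar w x * torusChar w y := by
  simp [torusChar, Finset.sum_add_distrib, AddCircle.toCircle_add]

theorem torusChar_linearAction {n : ℕ} (hn : Odd n) (k : SL(2, ℤ)) (w : Fin n → ℤ) (x : Torus n) :
    letI := linearAction n hn
    torusChar w ((QuotientGroup.mk k : PSL(2, ℤ)) • x) = torusChar (w ᵥ* rho n k) x := by
  rw [linearAction_mk_smul, torusChar, torusChar]
  congr 2
  simp only [Finset.smul_sum, Matrix.vecMul, dotProduct, Finset.sum_smul, mul_smul]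
  exact Finset.sum_comm

theorem integral_torusChar {n : ℕ} {w : Fin n → ℤ} (hw : w ≠ 0) :
    ∫ x : Torus n, torusChar w x = 0 := by
  obtain ⟨i, hi⟩ := Function.ne_iff.1 hw
  -- The point `y` is half a period in a direction on which the character is nontrivial.
  set y : Torus n := Pi.single i (((1 / (2 * w i) : ℝ) : UnitAddCircle)) with hy
  have hsum : ∑ j, w j • y j = ((1 / 2 : ℝ) : UnitAddCircle) := by
    rw [Finset.sum_eq_single i (fun j _ hj => by simp [hy, hj]) (by simp), hy, Pi.single_eq_same,
      ← AddCircle.coe_zsmul, zsmul_eq_mul]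
    congr 1
    have : (w i : ℝ) ≠ 0 := by exact_mod_cast hi
    field_simp
  have hy1 : torusChar w y = -1 := by
    rw [torusChar, hsum, AddCircle.toCircle_apply_mk, Circle.coe_exp]
    rw [show ((2 * Real.pi / 1 * (1 / 2) : ℝ) : ℂ) = Real.pi by push_cast; ring]
    exact Complex.exp_pi_mul_I
  have h := integral_add_right_eq_self (μ := (volume : Measure (Torus n))) (torusChar w) y
  simp only [torusChar_add, hy1, mul_neg, mul_one, integral_neg] at h
  exact CharZero.neg_eq_self_iff.1 h

end

end LinearTorusAction

theorem mainTheorem2 (n : ℕ) (hn : Odd n) (H : Subgroup PSL(2, ℤ)) (hH : IsAmenableGroup H) :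
    letI := LinearTorusAction.linearAction n hn
    ¬ ErgodicSMul H (LinearTorusAction.Torus n) (volume : Measure (LinearTorusAction.Torus n)) := by
  let := LinearTorusAction.linearAction n hn
  intro herg
  obtain ⟨O, hne, h0, hO⟩ := LinearTorusAction.exists_finite_invariant hn hH
  set f : LinearTorusAction.Torus n → ℝ :=
    fun x => ∑ w ∈ O, (LinearTorusAction.torusChar w x).re with hf
  have hcont : Continuous f := by
    have := fun w => LinearTorusAction.continuous_torusChar (n := n) w
    fun_prop
  have hint : ∀ g : LinearTorusAction.Torus n → ℂ, Continuous g → Integrable g := fun g hg =>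
    hg.integrable_of_hasCompactSupport (HasCompactSupport.of_compactSpace g)
  have hzero : ∫ x, f x = 0 := by
    have hsum : ∫ x, f x = ∑ w ∈ O, ∫ x, (LinearTorusAction.torusChar w x).re :=
      integral_finsetSum _ fun w _ => (hint _ (LinearTorusAction.continuous_torusChar w)).re
    rw [hsum]
    refine Finset.sum_eq_zero fun w hw => ?_
    have h := integral_re (hint _ (LinearTorusAction.continuous_torusChar w))
    rw [LinearTorusAction.integral_torusChar (fun h => h0 (h ▸ hw))] at h
    simpa using h
  have hpos : 0 < f 0 := by
    simp only [hf, LinearTorusAction.torusChar, Pi.zero_apply, smul_zero, Finset.sum_const_zero,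
      AddCircle.toCircle_zero, Circle.coe_one, Complex.one_re, Finset.sum_const, nsmul_eq_mul,
      mul_one, Nat.cast_pos]
    exact hne.card_pos
  have hinv : ∀ (g : H) (x : LinearTorusAction.Torus n), f (g • x) = f x := by
    rintro ⟨g, hg⟩ x
    induction g using QuotientGroup.induction_on with
    | H k =>
      change f ((QuotientGroup.mk k : PSL(2, ℤ)) • x) = f x
      simp only [hf, LinearTorusAction.torusChar_linearAction]
      refine Finset.sum_bij (fun w _ => Matrix.vecMul w (LinearTorusAction.rho n k))
        (hO k hg) ?_ ?_ (fun _ _ => rfl)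
      · intro u _ u' _ h
        have h' := congrArg (fun z => Matrix.vecMul z (LinearTorusAction.rho n k⁻¹)) h
        simpa only [Matrix.vecMul_vecMul, ← map_mul, mul_inv_cancel, map_one,
          Matrix.vecMul_one] using h'
      · intro u hu
        refine ⟨_, hO k⁻¹ (H.inv_mem hg) u hu, ?_⟩
        rw [Matrix.vecMul_vecMul, ← map_mul, inv_mul_cancel, map_one, Matrix.vecMul_one]
  -- The invariant set `{f > 0}` is neither conull, since `f` has integral zero, nor null, since it
  -- is open and contains `0`.
  have hopen : IsOpen {x | 0 < f x} := isOpen_lt continuous_const hcont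
  have hconst := herg.aeconst_of_forall_preimage_smul_ae_eq hopen.measurableSet fun g => by
    apply Filter.EventuallyEq.of_eq
    ext x
    simp [hinv]
  rcases Filter.eventuallyConst_set.1 hconst with h | h
  · have hnonneg : 0 ≤ᵐ[volume] f := h.mono fun x hx => le_of_lt hx
    have hf0 := (integral_eq_zero_iff_of_nonneg_ae hnonneg
      (hcont.integrable_of_hasCompactSupport (HasCompactSupport.of_compactSpace f))).1 hzero
    exact hpos.ne' (congrFun (hcont.ae_eq_iff_eq volume continuous_zero |>.1 hf0) 0)
  · have hnull : volume {x | 0 < f x} = 0 := by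
      have h' : ∀ᵐ x, ¬ 0 < f x := h
      rw [ae_iff] at h'
      simpa using h'
    exact (hopen.measure_pos volume ⟨0, hpos⟩).ne' hnull
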